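/- Let $V$ be a vector space over a field $\mathbb F$ and let $L\langle V\rangle=\bigoplus_{n\ge 1}L\langle V\rangle_n$ be the free Lie algebra on $V$, graded so that $V$ has degree $1$, i.e. $L\langle V\rangle_n$ is spanned by the $n$-fold iterated Lie brackets of elements of $V$. Let $M\subseteq L\langle V\rangle$ be a Lie subalgebra generated in degree $1$, i.e. generated as a Lie algebra by $M_1$, where $M_n:=M\cap L\langle V\rangle_n$. Then $M$ is the free Lie algebra on the vector space $M_1$: there is an isomorphism of Lie algebras $L\langle M_1\rangle\to M$ that restricts to the inclusion $M_1\subseteq M$ on generators and is graded, i.e. maps $L\langle M_1\rangle_n$ onto $M_n$ for every $n$. -/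

import Mathlib

namespace FreeLieOn

/-- The elements of the free Lie algebra on the underlying set of `V` that measure the failure of
the inclusion of generators `V → FreeLieAlgebra K V` to be `K`-linear. -/
def linearityRelations (K : Type*) (V : Type*) [Field K] [AddCommGroup V] [Module K V] :
    Set (FreeLieAlgebra K V) :=
  {r | ∃ v w : V, r = FreeLieAlgebra.of K (v + w) -
      (FreeLieAlgebra.of K v + FreeLieAlgebra.of K w)} ∪
  {r | ∃ (a : K) (v : V), r = FreeLieAlgebra.of K (a • v) - a • FreeLieAlgebra.of K v}

/-- The Lie ideal generated by the linearity relations. -/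
noncomputable def linearityIdeal (K : Type*) (V : Type*) [Field K] [AddCommGroup V]
    [Module K V] : LieIdeal K (FreeLieAlgebra K V) :=
  LieSubmodule.lieSpan K (FreeLieAlgebra K V) (linearityRelations K V)

/-- The free Lie algebra `L⟨V⟩` on a `K`-vector space `V`: the Lie algebra generated by the
elements of `V`, subject to the linear relations that hold in `V`. Equivalently, it is the value
at `V` of the left adjoint of the forgetful functor from Lie algebras to vector spaces. -/
abbrev _root_.FreeLieOn (K : Type*) (V : Type*) [Field K] [AddCommGroup V] [Module K V] :=
  FreeLieAlgebra K V ⧸ linearityIdeal K V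

/-- The canonical linear map `V → L⟨V⟩`. -/
noncomputable def incl (K : Type*) (V : Type*) [Field K] [AddCommGroup V] [Module K V] :
    V →ₗ[K] FreeLieOn K V where
  toFun v := LieSubmodule.Quotient.mk (FreeLieAlgebra.of K v)
  map_add' v w := by
    rw [← LieSubmodule.Quotient.mk'_apply, ← LieSubmodule.Quotient.mk'_apply,
      ← LieSubmodule.Quotient.mk'_apply, ← map_add, ← sub_eq_zero, ← map_sub,
      LieSubmodule.Quotient.mk'_apply, LieSubmodule.Quotient.mk_eq_zero']
    exact LieSubmodule.subset_lieSpan (Or.inl ⟨v, w, rfl⟩)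
  map_smul' a v := by
    rw [← LieSubmodule.Quotient.mk'_apply, ← LieSubmodule.Quotient.mk'_apply,
      RingHom.id_apply, ← map_smul, ← sub_eq_zero, ← map_sub,
      LieSubmodule.Quotient.mk'_apply, LieSubmodule.Quotient.mk_eq_zero']
    exact LieSubmodule.subset_lieSpan (Or.inr ⟨a, v, rfl⟩)

/-- `IsMonomial n x` says that `x` is an iterated Lie bracket, bracketed in any way, of `n`
elements of `V`. -/
inductive IsMonomial {K : Type*} {V : Type*} [Field K] [AddCommGroup V] [Module K V] :
    ℕ → FreeLieOn K V → Prop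
  | gen (v : V) : IsMonomial 1 (incl K V v)
  | lie {m n : ℕ} {x y : FreeLieOn K V} :
      IsMonomial m x → IsMonomial n y → IsMonomial (m + n) ⁅x, y⁆

/-- The homogeneous component `L⟨V⟩ₙ` of degree `n`, in the grading for which `V` has
degree `1`: the span of the `n`-fold brackets of elements of `V` (it is zero for `n = 0`). -/
noncomputable def component (K : Type*) (V : Type*) [Field K] [AddCommGroup V] [Module K V] (n : ℕ) :
    Submodule K (FreeLieOn K V) :=
  Submodule.span K {x | IsMonomial n x}

/-- The degree `n` part `Mₙ = M ∩ L⟨V⟩ₙ` of a Lie subalgebra `M` of `L⟨V⟩`. -/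
noncomputable def degreePart {K : Type*} {V : Type*} [Field K] [AddCommGroup V] [Module K V]
    (M : LieSubalgebra K (FreeLieOn K V)) (n : ℕ) : Submodule K (FreeLieOn K V) :=
  M.toSubmodule ⊓ component K V n

/-- `M` is generated in degree `1`: as a Lie algebra, it is generated by `M₁`. -/
def IsOneGenerated {K : Type*} {V : Type*} [Field K] [AddCommGroup V] [Module K V]
    (M : LieSubalgebra K (FreeLieOn K V)) : Prop :=
  LieSubalgebra.lieSpan K (FreeLieOn K V) (degreePart M 1 : Set (FreeLieOn K V)) = M

end FreeLieOn

/-! Over a field, `M₁` has a linear retraction. By the universal property, the inclusion of `M₁`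
induces `φ : L⟨M₁⟩ → M`, and the retraction induces `ρ : L⟨V⟩ → L⟨M₁⟩`. The composite `ρ ∘ φ` fixes
generators, so it is the identity and `φ` is injective; `φ` is onto because `M₁` generates `M`. Both
maps send generators to generators, so they preserve degree (`map_component_le`). -/

namespace FreeLieOn

section UniversalProperty

variable {K V L : Type*} [Field K] [AddCommGroup V] [Module K V] [LieRing L] [LieAlgebra K L]

/-- The Lie algebra homomorphism `L⟨V⟩ → L` induced by a linear map `V → L`. -/
noncomputable def lift (f : V →ₗ[K] L) : FreeLieOn K V →ₗ⁅K⁆ L where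
  __ := (linearityIdeal K V).toSubmodule.liftQ
    (FreeLieAlgebra.lift K f : FreeLieAlgebra K V →ₗ[K] L) (by
      have h : linearityIdeal K V ≤ (FreeLieAlgebra.lift K f).ker := by
        refine LieSubmodule.lieSpan_le.mpr ?_
        rintro _ (⟨v, w, rfl⟩ | ⟨a, v, rfl⟩) <;> simp
      exact fun x hx => (FreeLieAlgebra.lift K f).mem_ker.mp (h hx))
  map_lie' {x y} := by
    obtain ⟨x, rfl⟩ := LieSubmodule.Quotient.surjective_mk' (linearityIdeal K V) x
    obtain ⟨y, rfl⟩ := LieSubmodule.Quotient.surjective_mk' (linearityIdeal K V) y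
    exact (FreeLieAlgebra.lift K f).map_lie x y

@[simp]
theorem lift_incl (f : V →ₗ[K] L) (v : V) : lift f (incl K V v) = f v :=
  FreeLieAlgebra.lift_of_apply f v

theorem hom_ext {f g : FreeLieOn K V →ₗ⁅K⁆ L} (h : ∀ v, f (incl K V v) = g (incl K V v)) :
    f = g := by
  let π : FreeLieAlgebra K V →ₗ⁅K⁆ FreeLieOn K V :=
    { (LieSubmodule.Quotient.mk' (linearityIdeal K V) :
        FreeLieAlgebra K V →ₗ[K] FreeLieOn K V) with
      map_lie' := fun {x y} => LieSubmodule.Quotient.mk_bracket _ x y }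
  have hπ : f.comp π = g.comp π := FreeLieAlgebra.hom_ext h
  ext x
  obtain ⟨x, rfl⟩ := LieSubmodule.Quotient.surjective_mk' (linearityIdeal K V) x
  exact LieHom.congr_fun hπ x

end UniversalProperty

variable {K V W : Type*} [Field K] [AddCommGroup V] [Module K V] [AddCommGroup W] [Module K W]

theorem IsMonomial.pos {n : ℕ} {x : FreeLieOn K V} (h : IsMonomial n x) : 0 < n := by
  induction h with
  | gen v => exact one_pos
  | lie _ _ hm _ => exact Nat.add_pos_left hm _

/-- Degrees are positive, so a bracket has degree at least `2`. -/
theorem IsMonomial.exists_incl_eq {x : FreeLieOn K V} (h : IsMonomial 1 x) :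
    ∃ v, incl K V v = x := by
  generalize hn : 1 = n at h
  cases h with
  | gen v => exact ⟨v, rfl⟩
  | lie hx hy =>
    have := hx.pos
    have := hy.pos
    omega

theorem component_one_le : component K V 1 ≤ LinearMap.range (incl K V) :=
  Submodule.span_le.mpr fun _ h => h.exists_incl_eq

/-- A homomorphism that sends generators to generators preserves degrees. -/
theorem map_component_le (f : FreeLieOn K V →ₗ⁅K⁆ FreeLieOn K W)
    (hf : ∀ v, ∃ w, f (incl K V v) = incl K W w) (n : ℕ) :
    (component K V n).map (f : FreeLieOn K V →ₗ[K] FreeLieOn K W) ≤ component K W n := by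
  rw [component, Submodule.map_span_le]
  intro x hx
  refine Submodule.subset_span ?_
  change IsMonomial n (f x)
  induction hx with
  | gen v =>
    obtain ⟨w, hw⟩ := hf v
    exact hw ▸ .gen w
  | lie _ _ hx hy => exact f.map_lie _ _ ▸ .lie hx hy

end FreeLieOn

theorem theorem5p1 {K : Type*} {V : Type*} [Field K] [AddCommGroup V] [Module K V]
    (M : LieSubalgebra K (FreeLieOn K V)) (hM : FreeLieOn.IsOneGenerated M) :
    ∃ e : FreeLieOn K (FreeLieOn.degreePart M 1) ≃ₗ⁅K⁆ M,
      (∀ v : FreeLieOn.degreePart M 1,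
        (e (FreeLieOn.incl K (FreeLieOn.degreePart M 1) v) : FreeLieOn K V) = v) ∧
      ∀ n : ℕ,
        (FreeLieOn.component K (FreeLieOn.degreePart M 1) n).map
            (M.toSubmodule.subtype ∘ₗ (e : FreeLieOn K (FreeLieOn.degreePart M 1) →ₗ[K] M)) =
          FreeLieOn.degreePart M n := by
  set W := FreeLieOn.degreePart M 1
  have hincl (w : W) : ∃ v, FreeLieOn.incl K V v = w := FreeLieOn.component_one_le w.2.2
  let j : W →ₗ[K] M := Submodule.inclusion inf_le_left
  let φ : FreeLieOn K W →ₗ⁅K⁆ M := FreeLieOn.lift j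
  have hφ (w : W) : (φ (FreeLieOn.incl K W w) : FreeLieOn K V) = w :=
    congrArg Subtype.val (FreeLieOn.lift_incl j w)
  -- Retracting from all of `L⟨V⟩` avoids having to know that `incl K V` is injective.
  obtain ⟨r, hr⟩ := W.subtype.exists_leftInverse_of_injective W.ker_subtype
  let ρ : FreeLieOn K V →ₗ⁅K⁆ FreeLieOn K W :=
    FreeLieOn.lift (FreeLieOn.incl K W ∘ₗ r ∘ₗ FreeLieOn.incl K V)
  have hρ : (ρ.comp M.incl).comp φ = LieHom.id := by
    refine FreeLieOn.hom_ext fun w => ?_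
    obtain ⟨v, hv⟩ := hincl w
    change ρ (φ (FreeLieOn.incl K W w) : FreeLieOn K V) = FreeLieOn.incl K W w
    rw [hφ, ← hv, FreeLieOn.lift_incl]
    change FreeLieOn.incl K W (r (FreeLieOn.incl K V v)) = FreeLieOn.incl K W w
    rw [hv]
    exact congrArg (FreeLieOn.incl K W) (LinearMap.congr_fun hr w)
  have hρφ (x : FreeLieOn K W) : ρ (φ x : FreeLieOn K V) = x := LieHom.congr_fun hρ x
  have hsurj : Function.Surjective φ := by
    have hle : M ≤ (M.incl.comp φ).range := by
      conv_lhs => rw [← hM]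
      exact LieSubalgebra.lieSpan_le.mpr fun w hw => ⟨FreeLieOn.incl K W ⟨w, hw⟩, hφ ⟨w, hw⟩⟩
    intro x
    obtain ⟨y, hy⟩ := hle x.2
    exact ⟨y, Subtype.ext hy⟩
  refine ⟨LieEquiv.ofBijective φ ⟨fun x y h => ?_, hsurj⟩, hφ, fun n => le_antisymm ?_ ?_⟩
  · rw [← hρφ x, h, hρφ]
  · rintro _ ⟨x, hx, rfl⟩
    refine ⟨(φ x).2, FreeLieOn.map_component_le (M.incl.comp φ) (fun w => ?_) n ⟨x, hx, rfl⟩⟩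
    obtain ⟨v, hv⟩ := hincl w
    exact ⟨v, (hφ w).trans hv.symm⟩
  · rintro x ⟨hxM, hx⟩
    obtain ⟨y, hy⟩ := hsurj ⟨x, hxM⟩
    have hyx : (φ y : FreeLieOn K V) = x := congrArg Subtype.val hy
    refine ⟨y, ?_, hyx⟩
    -- The preimage `y` equals `ρ x`, so it inherits degree `n` from `x`.
    rw [← hρφ y, hyx]
    exact FreeLieOn.map_component_le ρ (fun v => ⟨_, FreeLieOn.lift_incl _ v⟩) n ⟨x, hx, rfl⟩
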